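/- Conventions. A represented space is a set $\mathbf X$ with a partial surjection $\delta:\subseteq\mathbb N^{\mathbb N}\to\mathbf X$; $p$ is a name of $\delta(p)$. A (multivalued) map is computable if a Type-2 machine (equivalently, a computable function on finite prefixes) turns each name of each point $x$ of its domain into a name of a (permitted) value at $x$. $\mathcal O(\mathbf X)$ is the represented space of open subsets of $\mathbf X$, identified with the continuous functions from $\mathbf X$ to Sierpi\'nski space: a name of $U$ codes a procedure that semidecides $x\in U$ from names of $x$. $\mathcal K(\mathbf X)$ is the represented space of saturated compact subsets of $\mathbf X$, where $K$ is identified with $\{U\in\mathcal O(\mathbf X)\mid K\subseteq U\}\in\mathcal O(\mathcal O(\mathbf X))$. $\mathbf X$ is computably compact if $\mathbf X$ itself is a computable point of $\mathcal K(\mathbf X)$. A computable metric space is a metric space $(\mathbf X,d)$, not necessarily complete, with a dense sequence $(a_i)_{i\in\mathbb N}$ such that the real numbers $d(a_i,a_j)$ are computable uniformly in $i,j$; it is represented by letting $p$ be a name of $x$ iff $d(x,a_{p(n)})<2^{-n}$ for all $n$. An effective relatively compact system (ercs) of $\mathbf X$ is a triple $((U_n)_{n\in\mathbb N},(B_n)_{n\in\mathbb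 N},R)$ of a computable sequence $(U_n)$ in $\mathcal O(\mathbf X)$, a computable sequence $(B_n)$ in $\mathcal K(\mathbf X)$, and a computably enumerable relation $R\subseteq\mathbb N\times\mathbb N$ such that $(m,n)\in R$ implies $U_m\subseteq B_n$, and such that for every $U\in\mathcal O(\mathbf X)$ $$U=\bigcup_{\{n\mid B_n\subseteq U\}}\ \bigcup_{\{m\mid (m,n)\in R\}}U_m .$$ Proposition. Let $(\mathbf X,d)$ be a computable metric space. Then the following are equivalent: 1. $\mathbf X$ admits an ercs. 2. The multivalued map $\operatorname{CompactBall}:\mathbf X\rightrightarrows\mathbb N\times\mathcal K(\mathbf X)$, where $(n,K)\in\operatorname{CompactBall}(x)$ iff $K=\overline B(x,2^{-n})=\{y\mid d(x,y)\le 2^{-n}\}$, is well-defined (every $x$ has at least one value) and computable. Consequently, every computably compact computable metric space admits an ercs. -/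

import Mathlib

namespace CompAnalysis

/-! ### Computability on Baire space -/

/-- The prefix of length `n` of an infinite sequence `p`. -/
def pre (p : ℕ → ℕ) (n : ℕ) : List ℕ := (List.range n).map p

/-- The word function `φ` computes the output sequence `q` on the input sequence `p`: given longer
and longer finite prefixes of `p`, `φ` eventually finds each value `q n`, and it never reports a
wrong one. (`φ w n = none` means that the prefix `w` is still too short to determine the `n`-th
output symbol.) -/
def Yields (φ : List ℕ → ℕ → Option ℕ) (p q : ℕ → ℕ) : Prop :=
  ∀ n k, (∃ m, φ (pre p m) n = some k) ↔ q n = k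

/-! ### Represented spaces -/

/-- A represented space: a set `X` with a partial surjection from Baire space onto `X`, given by
its graph. `IsName p x` says that `p` is in the domain of the representation and denotes `x`. -/
class RepresentedSpace (X : Type*) where
  /-- `p` is a name of `x`. -/
  IsName : (ℕ → ℕ) → X → Prop
  /-- A sequence names at most one point. -/
  unique : ∀ {p : ℕ → ℕ} {x y : X}, IsName p x → IsName p y → x = y
  /-- Every point has a name. -/
  exists_name : ∀ x : X, ∃ p, IsName p x

open RepresentedSpace

/-- A point of a represented space is computable if it has a computable name. -/
def IsComputablePoint {X : Type*} [RepresentedSpace X] (x : X) : Prop :=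
  ∃ p : ℕ → ℕ, Computable p ∧ IsName p x

/-- A partial multivalued map `f : ⊆ X ⇉ Y` with domain `{x | (f x).Nonempty}` is computable if a
computable word function turns every name of every `x` in the domain into a name of some
`y ∈ f x`. The choice of `y` may depend on the name of `x`. -/
def IsComputableMulti {X Y : Type*} [RepresentedSpace X] [RepresentedSpace Y]
    (f : X → Set Y) : Prop :=
  ∃ φ : List ℕ → ℕ → Option ℕ, Computable₂ φ ∧
    ∀ x, (f x).Nonempty → ∀ p, IsName p x → ∃ q, Yields φ p q ∧ ∃ y ∈ f x, IsName q y

/-- A total single-valued map between represented spaces is computable. -/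
def IsComputableMap {X Y : Type*} [RepresentedSpace X] [RepresentedSpace Y] (f : X → Y) : Prop :=
  IsComputableMulti fun x => ({f x} : Set Y)

/-- The represented space `ℕ`. -/
instance : RepresentedSpace ℕ where
  IsName p n := p 0 = n
  unique h₁ h₂ := h₁.symm.trans h₂
  exists_name n := ⟨fun _ => n, rfl⟩

/-- The product of two represented spaces: the two names are interleaved. -/
instance {X Y : Type*} [RepresentedSpace X] [RepresentedSpace Y] : RepresentedSpace (X × Y) where
  IsName r z := IsName (fun n => r (2 * n)) z.1 ∧ IsName (fun n => r (2 * n + 1)) z.2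
  unique h₁ h₂ := Prod.ext (unique h₁.1 h₂.1) (unique h₁.2 h₂.2)
  exists_name z := by
    obtain ⟨p, hp⟩ := exists_name z.1
    obtain ⟨q, hq⟩ := exists_name z.2
    refine ⟨fun n => if n % 2 = 0 then p (n / 2) else q (n / 2), ?_, ?_⟩
    · convert hp using 2 with n
      simp
    · convert hq using 2 with n
      have h₁ : (2 * n + 1) % 2 = 1 := by omega
      have h₂ : (2 * n + 1) / 2 = n := by omega
      simp [h₁, h₂]

/-! ### The spaces of open and of compact sets -/

/-- `p` codes a semidecision procedure for membership in `U`: the procedure, run on a name `q` of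
a point `x`, reads longer and longer prefixes of `q`, and it accepts once it has read a prefix
whose code is marked by `p`; it has to accept exactly the names of the points of `U`.
Equivalently, `p` codes a realizer of the characteristic function of `U` as a map from `X` to
Sierpinski space. -/
def Semidecides {X : Type*} [RepresentedSpace X] (p : ℕ → ℕ) (U : Set X) : Prop :=
  ∀ x q, IsName q x → (x ∈ U ↔ ∃ n, p (Encodable.encode (pre q n)) ≠ 0)

/-- The underlying set of `𝒪(X)`: the sets whose characteristic function into Sierpinski space is
continuous, that is, realized by some (not necessarily computable) procedure. -/
@[ext]
structure OpenSet (X : Type*) [RepresentedSpace X] where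
  /-- The underlying set. -/
  carrier : Set X
  exists_semidecides : ∃ p, Semidecides p carrier

/-- The represented space `𝒪(X)`. -/
instance {X : Type*} [RepresentedSpace X] : RepresentedSpace (OpenSet X) where
  IsName p U := Semidecides p U.carrier
  unique {p U V} hU hV := by
    ext x
    obtain ⟨q, hq⟩ := exists_name x
    rw [hU x q hq, hV x q hq]
  exists_name U := U.exists_semidecides

/-- The underlying set of `𝒦(X)`: the saturated sets `K` (those which are the intersection of
their open supersets) such that `{U ∈ 𝒪(X) | K ⊆ U}` belongs to `𝒪(𝒪(X))`. -/
@[ext]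
structure CompactSet (X : Type*) [RepresentedSpace X] where
  /-- The underlying set. -/
  carrier : Set X
  saturated : ∀ x, (∀ U : OpenSet X, carrier ⊆ U.carrier → x ∈ U.carrier) → x ∈ carrier
  exists_semidecides : ∃ p, Semidecides p {U : OpenSet X | carrier ⊆ U.carrier}

/-- The represented space `𝒦(X)`: a name of `K` is a name of `{U ∈ 𝒪(X) | K ⊆ U}` as an element
of `𝒪(𝒪(X))`. -/
instance {X : Type*} [RepresentedSpace X] : RepresentedSpace (CompactSet X) where
  IsName p K := Semidecides p {U : OpenSet X | K.carrier ⊆ U.carrier}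
  unique {p K L} hK hL := by
    have key : ∀ U : OpenSet X, K.carrier ⊆ U.carrier ↔ L.carrier ⊆ U.carrier := by
      intro U
      obtain ⟨q, hq⟩ := exists_name U
      exact (hK U q hq).trans (hL U q hq).symm
    ext x
    exact ⟨fun hx => L.saturated x fun U hU => (key U).2 hU hx,
      fun hx => K.saturated x fun U hU => (key U).1 hU hx⟩
  exists_name K := K.exists_semidecides

/-- `X` is computably compact: the whole space is a computable point of `𝒦(X)`, that is, one can
semidecide whether a given open set is all of `X`. -/
def IsComputablyCompact (X : Type*) [RepresentedSpace X] : Prop :=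
  ∃ K : CompactSet X, K.carrier = Set.univ ∧ IsComputablePoint K

/-- An effective relatively compact system (ercs) of a represented space. -/
structure Ercs (X : Type*) [RepresentedSpace X] where
  /-- The sequence of open sets. -/
  U : ℕ → OpenSet X
  /-- The sequence of compact sets. -/
  B : ℕ → CompactSet X
  /-- The formal containment relation, `(m, n) ∈ R` meaning `U m ≪ B n`. -/
  R : Set (ℕ × ℕ)
  computable_U : IsComputableMap U
  computable_B : IsComputableMap B
  re_R : REPred fun z : ℕ × ℕ => z ∈ R
  subset_of_mem : ∀ m n, (m, n) ∈ R → (U m).carrier ⊆ (B n).carrier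
  eq_iUnion : ∀ V : OpenSet X,
    V.carrier = ⋃ n ∈ {n | (B n).carrier ⊆ V.carrier}, ⋃ m ∈ {m | (m, n) ∈ R}, (U m).carrier

/-- `X` admits an ercs. -/
def AdmitsErcs (X : Type*) [RepresentedSpace X] : Prop := Nonempty (Ercs X)

/-! ### Computable metric spaces -/

/-- A computable metric space: a metric space (not necessarily complete) with a dense sequence on
which the distance is computable, that is, the double sequence of reals `dist (seq i) (seq j)` has
dyadic approximations computable to any precision. -/
class ComputableMetricSpace (X : Type*) [MetricSpace X] where
  /-- The dense sequence. -/
  seq : ℕ → X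
  dense_seq : DenseRange seq
  dist_computable : ∃ f : ℕ × ℕ × ℕ → ℕ, Computable f ∧
    ∀ i j k, |dist (seq i) (seq j) - f (i, j, k) / 2 ^ k| ≤ 1 / 2 ^ k

open ComputableMetricSpace

/-- The Cauchy representation of a computable metric space: `p` is a name of `x` if it lists
indices of points of the dense sequence that converge rapidly to `x`. -/
instance {X : Type*} [MetricSpace X] [ComputableMetricSpace X] : RepresentedSpace X where
  IsName p x := ∀ n, dist x (seq (p n)) < 1 / 2 ^ n
  unique {p x y} hx hy := by
    refine dist_le_zero.1 (le_of_forall_pos_lt_add fun ε hε => ?_)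
    obtain ⟨n, hn⟩ := exists_pow_lt_of_lt_one (half_pos hε) (by norm_num : (1 / 2 : ℝ) < 1)
    have h := dist_triangle_right x y (seq (p n))
    have h₁ := hx n
    have h₂ := hy n
    rw [one_div_pow] at hn
    linarith
  exists_name x := by
    have h : ∀ n : ℕ, ∃ i : ℕ, dist x (seq i) < 1 / 2 ^ n := fun n =>
      (dense_seq (X := X)).exists_dist_lt x (by positivity)
    choose p hp using h
    exact ⟨p, hp⟩

/-- The multivalued map `CompactBall : X ⇉ ℕ × 𝒦(X)`, which maps `x` to the pairs `(n, K)` such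
that `K` is the closed ball of radius `2⁻ⁿ` around `x`. -/
def compactBall (X : Type*) [MetricSpace X] [ComputableMetricSpace X] (x : X) :
    Set (ℕ × CompactSet X) :=
  {z | z.2.carrier = Metric.closedBall x (1 / 2 ^ z.1)}

end CompAnalysis

namespace CompAnalysis

open RepresentedSpace ComputableMetricSpace

/-! ### Finite prefixes -/

/-! Two mechanisms carry both implications. First, a subset `L` of a compact `K` with semidecidable
complement inherits a name: `L ⊆ U` iff `K ⊆ U ∪ Lᶜ` (`semidecides_sdiffName_of_subset`). The
exterior of a closed ball is semidecidable from a name of its centre (`semidecides_exteriorName`),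
so a name of a closed ball can be computed once some named compact set is known to contain it.
Second, a machine that has answered has read only a finite prefix, so its answer holds on a whole
neighbourhood; `prefixTest` certifies that a given ball lies inside that neighbourhood.

From an ercs to compact balls: given a name of `x`, search for `(m, n) ∈ R` and a prefix on which `U
m` is accepted, together with a radius so small that the closed ball around `x` consists of points
compatible with this prefix. The ball then lies in `U m ⊆ B n`, and its name is cut out of that of
`B n`.

From compact balls to an ercs: run the `CompactBall` machine on finite words. If it has announced
the exponent `n₀` after reading `w`, and `seq i` has a name starting with `w`, then the machine, fed
with `w` followed by `i, i, …`, delivers a name of the closed ball of radius `2⁻ⁿ⁰` around `seq i`,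
and all smaller concentric balls are cut out of it. Such balls form neighbourhood bases, which is
all that `admitsErcs_of_balls` needs. In a computably compact space the whole space can play the
role of the enclosing compact set. -/

@[simp] theorem length_pre (p : ℕ → ℕ) (n : ℕ) : (pre p n).length = n := by simp [pre]

theorem getD_pre {p : ℕ → ℕ} {n i : ℕ} (h : i < n) (d : ℕ) : (pre p n).getD i d = p i := by
  simp [pre, h]

theorem take_pre {p : ℕ → ℕ} {s n : ℕ} (h : s ≤ n) : (pre p n).take s = pre p s := by
  simp [pre, ← List.map_take, List.take_range, h]

theorem pre_congr {p q : ℕ → ℕ} {n : ℕ} (h : ∀ i < n, p i = q i) : pre p n = pre q n :=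
  List.map_congr_left fun i hi => h i (List.mem_range.1 hi)

theorem pre_getD (w : List ℕ) (d : ℕ) : pre (fun i => w.getD i d) w.length = w := by
  refine List.ext_getElem (by simp) fun i h₁ h₂ => ?_
  simp [pre, h₂]

/-! ### Closure properties of computable functions -/

section Computable

variable {α : Type*} [Primcodable α]

theorem computable_le {a b : α → ℕ} (ha : Computable a) (hb : Computable b) :
    Computable fun x => decide (a x ≤ b x) :=
  (Primrec.nat_le.decide.to_comp.comp ha hb :)

theorem computable_and {a b : α → Bool} (ha : Computable a) (hb : Computable b) :
    Computable fun x => a x && b x :=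
  (Primrec.and.to_comp.comp ha hb :)

theorem computable_add {a b : α → ℕ} (ha : Computable a) (hb : Computable b) :
    Computable fun x => a x + b x :=
  (Primrec.nat_add.to_comp.comp ha hb :)

theorem computable_sub {a b : α → ℕ} (ha : Computable a) (hb : Computable b) :
    Computable fun x => a x - b x :=
  (Primrec.nat_sub.to_comp.comp ha hb :)

theorem computable_mul {a b : α → ℕ} (ha : Computable a) (hb : Computable b) :
    Computable fun x => a x * b x :=
  (Primrec.nat_mul.to_comp.comp ha hb :)

theorem computable_two_pow {a : α → ℕ} (ha : Computable a) : Computable fun x => 2 ^ a x := by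
  refine (Computable.nat_rec (g := fun _ => 1) (h := fun _ z => z.2 * 2) ha (Computable.const 1)
    (computable_mul (Computable.snd.comp Computable.snd) (Computable.const 2)).to₂).of_eq
    fun x => ?_
  induction a x with
  | zero => rfl
  | succ n ih => simp only [ih, pow_succ]

theorem computable_toNat {a : α → Bool} (ha : Computable a) : Computable fun x => (a x).toNat :=
  (Computable.cond ha (Computable.const 1) (Computable.const 0)).of_eq fun x => by
    cases a x <;> rfl

theorem computable_getD {l : α → List ℕ} {i d : α → ℕ} (hl : Computable l) (hi : Computable i)
    (hd : Computable d) : Computable fun x => (l x).getD (i x) (d x) :=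
  (Computable.option_getD (Computable.list_getElem?.comp hl hi) hd).of_eq fun x => by
    simp [List.getD]

theorem computable_take {l : α → List ℕ} {n : α → ℕ} (hl : Computable l) (hn : Computable n) :
    Computable fun x => (l x).take (n x) :=
  (Primrec.list_take.to_comp.comp hn hl :)

theorem computable_pre {p : α → ℕ → ℕ} {n : α → ℕ} (hp : Computable₂ p) (hn : Computable n) :
    Computable fun x => pre (p x) (n x) := by
  refine (Computable.nat_rec (g := fun _ => []) (h := fun x z => z.2 ++ [p x z.1]) hn
    (Computable.const [])
    (Computable.list_concat.comp (Computable.snd.comp Computable.snd)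
      (hp.comp Computable.fst (Computable.fst.comp Computable.snd))).to₂).of_eq fun x => ?_
  induction n x with
  | zero => rfl
  | succ n ih => simp only [ih, pre, List.range_succ, List.map_append, List.map_cons, List.map_nil]

/-- Bounded universal quantification. -/
def allBelow (P : ℕ → Bool) (n : ℕ) : Bool := Nat.rec true (fun i r => r && P i) n

theorem allBelow_iff {P : ℕ → Bool} {n : ℕ} : allBelow P n = true ↔ ∀ i < n, P i = true := by
  induction n with
  | zero => simp [allBelow]
  | succ n ih =>
    have : allBelow P (n + 1) = (allBelow P n && P n) := rfl
    rw [this, Bool.and_eq_true, ih, Nat.forall_lt_succ_right]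

theorem computable_allBelow {P : α → ℕ → Bool} {n : α → ℕ} (hP : Computable₂ P)
    (hn : Computable n) : Computable fun x => allBelow (P x) (n x) :=
  Computable.nat_rec (g := fun _ => true) (h := fun x z => z.2 && P x z.1) hn
    (Computable.const true)
    (computable_and (Computable.snd.comp Computable.snd)
      (hP.comp Computable.fst (Computable.fst.comp Computable.snd))).to₂

/-- The least number below `n` satisfying `P`. -/
def firstBelow (P : ℕ → Bool) (n : ℕ) : Option ℕ :=
  Nat.rec none (fun i r => Option.casesOn r (bif P i then some i else none) some) n

theorem firstBelow_eq_some {P : ℕ → Bool} {n s : ℕ} :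
    firstBelow P n = some s ↔ s < n ∧ P s = true ∧ ∀ t < s, P t = false := by
  have aux : ∀ n, (firstBelow P n = none → ∀ t < n, P t = false) ∧
      ∀ s, firstBelow P n = some s → s < n ∧ P s = true ∧ ∀ t < s, P t = false := by
    intro n
    induction n with
    | zero => simp [firstBelow]
    | succ n ih =>
      have h : firstBelow P (n + 1) =
        Option.casesOn (firstBelow P n) (bif P n then some n else none) some := rfl
      rw [h]
      rcases hc : firstBelow P n with _ | s
      · have h₀ := ih.1 hc
        cases hP : P n
        · simpa [Nat.forall_lt_succ_right, hP, -Order.lt_add_one_iff] using h₀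
        · simp only [cond_true, reduceCtorEq, false_implies, Option.some.injEq, true_and]
          rintro s rfl
          exact ⟨by omega, hP, h₀⟩
      · have h₀ := ih.2 s hc
        simp only [reduceCtorEq, false_implies, Option.some.injEq, true_and]
        rintro s rfl
        exact ⟨by omega, h₀.2⟩
  refine ⟨(aux n).2 s, fun ⟨h₁, h₂, h₃⟩ => ?_⟩
  rcases hc : firstBelow P n with _ | t
  · simp [(aux n).1 hc s h₁] at h₂
  · obtain ⟨-, h₅, h₆⟩ := (aux n).2 t hc
    rcases lt_trichotomy s t with h | h | h
    · simp [h₆ s h] at h₂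
    · rw [h]
    · simp [h₃ t h] at h₅

theorem computable_firstBelow {P : α → ℕ → Bool} {n : α → ℕ} (hP : Computable₂ P)
    (hn : Computable n) : Computable fun x => firstBelow (P x) (n x) := by
  have hstep : Computable fun y : α × ℕ × Option ℕ =>
      (bif P y.1 y.2.1 then some y.2.1 else none : Option ℕ) :=
    Computable.cond (hP.comp Computable.fst (Computable.fst.comp Computable.snd))
      (Computable.option_some.comp (Computable.fst.comp Computable.snd)) (Computable.const none)
  exact Computable.nat_rec (g := fun _ => none)
    (h := fun x z => Option.casesOn z.2 (bif P x z.1 then some z.1 else none) some) hn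
    (Computable.const none)
    (Computable.option_casesOn (Computable.snd.comp Computable.snd) hstep
      (Computable.option_some.comp Computable.snd).to₂).to₂

/-- A recursively enumerable predicate is the projection of a decidable one. -/
theorem exists_computable_of_rePred {P : α → Prop} (h : REPred P) :
    ∃ g : α → ℕ → Bool, Computable₂ g ∧ ∀ x, P x ↔ ∃ t, g x t = true := by
  obtain ⟨c, hc⟩ := Nat.Partrec.Code.exists_code.1 h
  refine ⟨fun x t => (c.evaln t (Encodable.encode x)).isSome, ?_, fun x => ?_⟩
  · have h₁ : Computable fun z : α × ℕ => c.evaln z.2 (Encodable.encode z.1) :=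
      Nat.Partrec.Code.primrec_evaln.to_comp.comp
        ((Computable.snd.pair (Computable.const c)).pair (Computable.encode.comp Computable.fst))
    exact Primrec.option_isSome.to_comp.comp h₁
  · have h₁ : P x ↔ (c.eval (Encodable.encode x)).Dom := by
      rw [hc]
      simp [Part.assert, Part.bind]
    rw [h₁, Part.dom_iff_mem]
    simp only [Nat.Partrec.Code.evaln_complete, Option.isSome_iff_exists, Option.mem_def]
    exact exists_comm

/-- Unbounded search that succeeds everywhere computes a total function. -/
theorem exists_computable_of_search {F : α → ℕ → Option ℕ} (hF : Computable₂ F)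
    (h : ∀ x, ∃ m k, F x m = some k) :
    ∃ b : α → ℕ, Computable b ∧ ∀ x, ∃ m, F x m = some (b x) := by
  have hdom : ∀ x, (Nat.rfindOpt (F x)).Dom := fun x => Nat.rfindOpt_dom.2 (h x)
  refine ⟨fun x => (Nat.rfindOpt (F x)).get (hdom x),
    (Partrec.rfindOpt hF).of_eq_tot fun x => Part.get_mem _, fun x => ?_⟩
  exact Nat.rfindOpt_spec (Part.get_mem (hdom x))

end Computable

/-! ### Computable sequences and search procedures -/

/-- A sequence is computable iff its members have uniformly computable names. -/
theorem isComputableMap_nat_iff {Y : Type*} [RepresentedSpace Y] {F : ℕ → Y} :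
    IsComputableMap F ↔ ∃ b : ℕ → ℕ → ℕ, Computable₂ b ∧ ∀ n, IsName (b n) (F n) := by
  constructor
  · rintro ⟨φ, hφ, h⟩
    have h' : ∀ n, ∃ q, Yields φ (fun _ => n) q ∧ IsName q (F n) := fun n => by
      obtain ⟨q, hq, y, hy, hqy⟩ := h n ⟨_, rfl⟩ (fun _ => n) rfl
      exact ⟨q, hq, hy ▸ hqy⟩
    have hF : Computable₂ fun (z : ℕ × ℕ) m => φ (pre (fun _ => z.1) m) z.2 :=
      hφ.comp (computable_pre (Computable.fst.comp (Computable.fst.comp Computable.fst)).to₂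
        Computable.snd) (Computable.snd.comp Computable.fst)
    obtain ⟨b, hb, hb'⟩ := exists_computable_of_search hF fun z => by
      obtain ⟨q, hq, -⟩ := h' z.1
      obtain ⟨m, hm⟩ := (hq z.2 (q z.2)).2 rfl
      exact ⟨m, _, hm⟩
    refine ⟨fun n e => b (n, e), hb, fun n => ?_⟩
    obtain ⟨q, hq, hqn⟩ := h' n
    convert hqn using 1
    exact funext fun e => ((hq e _).1 (hb' (n, e))).symm
  · rintro ⟨b, hb, h⟩
    -- A name of `n` carries all its information in symbol `0`, so a prefix of length one suffices.
    refine ⟨fun w e => w[0]?.map fun n => b n e, ?_, ?_⟩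
    · exact Computable.option_map (Computable.list_getElem?.comp Computable.fst
        (Computable.const 0)) (hb.comp Computable.snd (Computable.snd.comp Computable.fst)).to₂
    · rintro n - p (rfl : p 0 = n)
      refine ⟨b (p 0), fun e k => ⟨?_, ?_⟩, _, rfl, h _⟩
      · rintro ⟨m, hm⟩
        cases m with
        | zero => simp [pre] at hm
        | succ m => simpa [pre] using hm
      · rintro rfl
        exact ⟨1, by simp [pre]⟩

/-- To compute a multivalued map it suffices to search for a prefix of the input which passes a
test, and then to compute the symbols of the output from that prefix's length and longer prefixes
of the input. -/
theorem isComputableMulti_of_search {X Y : Type*} [RepresentedSpace X] [RepresentedSpace Y]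
    {f : X → Set Y} {good : List ℕ → Bool} {out : List ℕ → ℕ → ℕ → ℕ} (hgood : Computable good)
    (hout : Computable fun z : List ℕ × ℕ × ℕ => out z.1 z.2.1 z.2.2)
    (hex : ∀ (x : X) p, IsName p x → ∃ s, good (pre p s) = true)
    (hval : ∀ (x : X) p s, IsName p x → good (pre p s) = true →
      ∃ y ∈ f x, IsName (fun e => out (pre p (e + 1)) s e) y) :
    IsComputableMulti f := by
  -- Taking the least passing length makes all output symbols refer to the same `s`, and truncating
  -- to `e + 1` symbols keeps the reported value unchanged on longer inputs. The bound `w.length +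
  -- 1` admits `w` itself as a candidate.
  refine ⟨fun w e => bif decide (e + 1 ≤ w.length) then
    (firstBelow (fun s => good (w.take s)) (w.length + 1)).map fun s => out (w.take (e + 1)) s e
    else none, ?_, fun x _ p hp => ?_⟩
  · have hw : Computable fun z : List ℕ × ℕ => z.1 := Computable.fst
    refine Computable.cond (computable_le (Computable.succ.comp Computable.snd)
      (Computable.list_length.comp hw)) (Computable.option_map (computable_firstBelow
        (hgood.comp (computable_take (hw.comp Computable.fst) Computable.snd)).to₂
        (Computable.succ.comp (Computable.list_length.comp hw))) ?_) (Computable.const none)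
    exact hout.comp ((computable_take (hw.comp Computable.fst)
      (Computable.succ.comp (Computable.snd.comp Computable.fst))).pair
      (Computable.snd.pair (Computable.snd.comp Computable.fst)))
  · have hs := hex x p hp
    classical
    obtain ⟨y, hy, hn⟩ := hval x p (Nat.find hs) hp (Nat.find_spec hs)
    refine ⟨_, fun e k => ⟨?_, ?_⟩, y, hy, hn⟩
    · rintro ⟨m, hm⟩
      by_cases hem : e + 1 ≤ m
      · simp only [length_pre, hem, decide_true, cond_true, Option.map_eq_some_iff] at hm
        obtain ⟨s, h₁, h₂⟩ := hm
        obtain ⟨h₃, h₄, h₅⟩ := firstBelow_eq_some.1 h₁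
        rw [take_pre (by omega)] at h₄ h₂
        have : Nat.find hs = s := by
          refine (Nat.find_eq_iff hs).2 ⟨h₄, fun t ht => ?_⟩
          have := h₅ t ht
          rw [take_pre (by omega)] at this
          simp [this]
        rw [this]
        exact h₂
      · simp [hem] at hm
    · rintro rfl
      refine ⟨max (e + 1) (Nat.find hs), ?_⟩
      have : firstBelow (fun s => good ((pre p (max (e + 1) (Nat.find hs))).take s))
          (max (e + 1) (Nat.find hs) + 1) = some (Nat.find hs) := by
        refine firstBelow_eq_some.2 ⟨by omega, ?_, fun t ht => ?_⟩
        · rw [take_pre (by omega)]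
          exact Nat.find_spec hs
        · rw [take_pre (by omega)]
          simpa using Nat.find_min hs ht
      simp only [length_pre, this, le_max_left, decide_true, cond_true, Option.map_some]
      rw [take_pre (by omega)]

/-! ### Intersecting a compact set with a closed set -/

/-- The name of `K \ E` obtained from a name `b` of the compact set `K` and a name `g` of the open
set `E`: the sum of a name of `U` and of `g` is a name of `U ∪ E`. -/
def sdiffName (b g : ℕ → ℕ) (e : ℕ) : ℕ :=
  b (Encodable.encode (pre (fun i => (Denumerable.ofNat (List ℕ) e).getD i 0 + g i)
    (Denumerable.ofNat (List ℕ) e).length))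

/-- `K \ E ⊆ U` iff `K ⊆ U ∪ E`, and a sum of natural numbers is nonzero iff one of the summands is.
-/
theorem semidecides_sdiffName {X : Type*} [RepresentedSpace X] {K E : Set X} {b g : ℕ → ℕ}
    (hb : Semidecides b {U : OpenSet X | K ⊆ U.carrier}) (hg : Semidecides g E) :
    Semidecides (sdiffName b g) {U : OpenSet X | K \ E ⊆ U.carrier} := by
  intro U q hq
  have hs : Semidecides (fun i => q i + g i) (U.carrier ∪ E) := fun x r hr => by
    rw [Set.mem_union, hq x r hr, hg x r hr, ← exists_or]
    exact exists_congr fun n => by simp only; omega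
  have h := hb ⟨U.carrier ∪ E, _, hs⟩ _ hs
  rw [Set.mem_ofPred_eq, Set.sdiff_subset_iff, Set.union_comm]
  refine h.trans (exists_congr fun n => ?_)
  have : pre (fun i => (pre q n).getD i 0 + g i) n = pre (fun i => q i + g i) n :=
    pre_congr fun i hi => by rw [getD_pre hi]
  simp only [sdiffName, Denumerable.ofNat_encode, length_pre, this]

/-- A subset of `K` with open complement is compact. -/
theorem semidecides_sdiffName_of_subset {X : Type*} [RepresentedSpace X] {K L : Set X}
    {b g : ℕ → ℕ} (hb : Semidecides b {U : OpenSet X | K ⊆ U.carrier}) (hg : Semidecides g Lᶜ)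
    (h : L ⊆ K) : Semidecides (sdiffName b g) {U : OpenSet X | L ⊆ U.carrier} := by
  have hL : K \ Lᶜ = L := by
    ext x
    simpa using @h x
  simpa only [hL] using semidecides_sdiffName hb hg

theorem length_ofNat_le (e : ℕ) : (Denumerable.ofNat (List ℕ) e).length ≤ e := by
  conv_rhs => rw [← Denumerable.encode_ofNat (α := List ℕ) e]
  exact Encodable.length_le_encode _

/-- A list with code `e` has length at most `e`, which bounds how much of the name of the open set
is consulted. Output symbols are therefore computable from finite prefixes. -/
theorem sdiffName_congr {b g g' : ℕ → ℕ} {e : ℕ} (h : ∀ i < e, g i = g' i) :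
    sdiffName b g e = sdiffName b g' e := by
  unfold sdiffName
  rw [pre_congr fun i hi => by rw [h i (hi.trans_le (length_ofNat_le e))]]

theorem computable_sdiffName {α : Type*} [Primcodable α] {b g : α → ℕ → ℕ} (hb : Computable₂ b)
    (hg : Computable₂ g) : Computable₂ fun a e => sdiffName (b a) (g a) e := by
  have hl : Computable fun z : α × ℕ => Denumerable.ofNat (List ℕ) z.2 :=
    (Computable.ofNat _).comp Computable.snd
  refine hb.comp Computable.fst (Computable.encode.comp (computable_pre ?_
    (Computable.list_length.comp hl)))
  exact computable_add (computable_getD (hl.comp Computable.fst) Computable.snd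
    (Computable.const 0)) (hg.comp (Computable.fst.comp Computable.fst) Computable.snd)

/-! ### Topology of computable metric spaces -/

theorem eventually_const_div_two_pow_lt (c : ℝ) {δ : ℝ} (hδ : 0 < δ) :
    ∀ᶠ l : ℕ in Filter.atTop, c / 2 ^ l < δ := by
  have h : Filter.Tendsto (fun l : ℕ => c * (1 / 2 : ℝ) ^ l) Filter.atTop (nhds (c * 0)) :=
    (tendsto_pow_atTop_nhds_zero_of_lt_one (by norm_num) (by norm_num)).const_mul c
  rw [mul_zero] at h
  filter_upwards [h.eventually_lt_const hδ] with l hl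
  rwa [one_div_pow, mul_one_div] at hl

section Metric

variable {X : Type*} [MetricSpace X] [ComputableMetricSpace X]

/-- The Cauchy representation imposes a separate condition on each entry, so every finite word
compatible with `y` extends to a name of `y`. -/
theorem isName_append {p q : ℕ → ℕ} {y : X} {n : ℕ} (hq : IsName q y)
    (h : ∀ i < n, dist y (seq (p i)) < 1 / 2 ^ i) :
    IsName (fun i => if i < n then p i else q i) y := by
  intro i
  by_cases hi : i < n
  · simpa [hi] using h i hi
  · simpa [hi] using hq i

theorem isName_const (i : ℕ) : IsName (fun _ => i) (seq i : X) := fun n => by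
  rw [dist_self]
  positivity

/-- Acceptance of a prefix is witnessed on a whole neighbourhood. -/
theorem Semidecides.mem_of_prefix {p u : ℕ → ℕ} {U : Set X} (hu : Semidecides u U) {n : ℕ}
    (hn : u (Encodable.encode (pre p n)) ≠ 0) {y : X}
    (h : ∀ i < n, dist y (seq (p i)) < 1 / 2 ^ i) : y ∈ U := by
  obtain ⟨q, hq⟩ := exists_name y
  refine (hu y _ (isName_append hq h)).2 ⟨n, ?_⟩
  rwa [pre_congr fun i hi => if_pos hi]

theorem isOpen_setOf_prefix (p : ℕ → ℕ) (n : ℕ) :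
    IsOpen {y : X | ∀ i < n, dist y (seq (p i)) < 1 / 2 ^ i} := by
  have : {y : X | ∀ i < n, dist y (seq (p i)) < 1 / 2 ^ i} =
      ⋂ i ∈ Set.Iio n, {y : X | dist y (seq (p i)) < 1 / 2 ^ i} := by
    ext y
    simp
  rw [this]
  exact (Set.finite_Iio n).isOpen_biInter fun i _ =>
    isOpen_lt (continuous_id.dist continuous_const) continuous_const

theorem Semidecides.isOpen {u : ℕ → ℕ} {U : Set X} (hu : Semidecides u U) : IsOpen U := by
  refine isOpen_iff_mem_nhds.2 fun x hx => ?_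
  obtain ⟨p, hp⟩ := exists_name x
  obtain ⟨n, hn⟩ := (hu x p hp).1 hx
  exact Filter.mem_of_superset ((isOpen_setOf_prefix p n).mem_nhds fun i _ => hp i)
    fun y hy => hu.mem_of_prefix hn hy

/-- A prefix is accepted when the ball described by its last entry lies in `U`. The test is
classical: no computability is claimed. -/
theorem exists_semidecides_of_isOpen {U : Set X} (hU : IsOpen U) : ∃ p, Semidecides p U := by
  classical
  let T : List ℕ → Prop := fun v => 0 < v.length ∧
    Metric.ball (seq (v.getD (v.length - 1) 0) : X) (1 / 2 ^ (v.length - 1)) ⊆ U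
  refine ⟨fun e => if T (Denumerable.ofNat _ e) then 1 else 0, fun x q hq => ?_⟩
  have hT : ∀ n, T (pre q (n + 1)) ↔ Metric.ball (seq (q n) : X) (1 / 2 ^ n) ⊆ U := fun n => by
    simp only [T, length_pre, Nat.add_sub_cancel, getD_pre n.lt_succ_self, n.succ_pos, true_and]
  simp only [Denumerable.ofNat_encode]
  constructor
  · intro hx
    obtain ⟨ε, hε, h⟩ := Metric.isOpen_iff.1 hU x hx
    obtain ⟨n, hn⟩ := (eventually_const_div_two_pow_lt 2 hε).exists
    refine ⟨n + 1, ?_⟩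
    rw [if_pos ((hT n).2 fun y hy => h ?_)]
    · exact one_ne_zero
    · have h₁ := hq n
      have h₂ := dist_triangle_right y x (seq (q n))
      rw [Metric.mem_ball] at hy ⊢
      have : (2 : ℝ) / 2 ^ n = 1 / 2 ^ n + 1 / 2 ^ n := by ring
      linarith
  · rintro ⟨n, hn⟩
    have hn' : T (pre q n) := by
      by_contra hc
      exact hn (if_neg hc)
    cases n with
    | zero => simp [T] at hn'
    | succ n => exact (hT n).1 hn' (hq n)

/-- The open set of a represented metric space with a given underlying set. -/
def OpenSet.ofIsOpen (U : Set X) (hU : IsOpen U) : OpenSet X := ⟨U, exists_semidecides_of_isOpen hU⟩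

theorem OpenSet.isOpen (U : OpenSet X) : IsOpen U.carrier :=
  let ⟨_, hu⟩ := U.exists_semidecides
  hu.isOpen

/-- The compact set of a represented metric space with a given underlying set and name. -/
def CompactSet.ofSemidecides (K : Set X) (p : ℕ → ℕ)
    (h : Semidecides p {U : OpenSet X | K ⊆ U.carrier}) : CompactSet X where
  carrier := K
  saturated x hx := by
    -- Points are closed, so the complement of a point outside `K` is an open superset of `K`.
    by_contra hc
    exact hx (OpenSet.ofIsOpen {x}ᶜ isOpen_compl_singleton)
      (Set.subset_compl_singleton_iff.2 hc) rfl
  exists_semidecides := ⟨p, h⟩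

/-! ### Decidable tests for distances

In this section `f` approximates the distances between points of the dense sequence. -/

/-- `f` computes dyadic approximations of the distances between points of the dense sequence. -/
def ApproximatesDist (X : Type*) [MetricSpace X] [ComputableMetricSpace X]
    (f : ℕ × ℕ × ℕ → ℕ) : Prop :=
  ∀ i j k, |dist (seq i : X) (seq j) - f (i, j, k) / 2 ^ k| ≤ 1 / 2 ^ k

variable {f : ℕ × ℕ × ℕ → ℕ}

theorem ApproximatesDist.le (hf : ApproximatesDist X f) (i j k : ℕ) :
    dist (seq i : X) (seq j) ≤ f (i, j, k) / 2 ^ k + 1 / 2 ^ k := by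
  linarith [(abs_le.1 (hf i j k)).2]

theorem ApproximatesDist.ge (hf : ApproximatesDist X f) (i j k : ℕ) :
    f (i, j, k) / 2 ^ k ≤ dist (seq i : X) (seq j) + 1 / 2 ^ k := by
  linarith [(abs_le.1 (hf i j k)).1]

/-- The test accepts if the prefix `v` proves that a point has distance more than `1 / 2 ^ k` from
every point which is `1 / 2 ^ (v.length - 1)`-close to `seq b`. -/
def farTest (f : ℕ × ℕ × ℕ → ℕ) (b k : ℕ) (v : List ℕ) : Bool :=
  decide (1 ≤ v.length) && decide (3 * 2 ^ k + 2 ^ (v.length - 1) ≤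
    f (b, v.getD (v.length - 1) 0, v.length - 1) * 2 ^ k)

/-- The test accepts if the prefix `v` proves that a point has distance less than `1 / 2 ^ r` from
`seq c`. -/
def nearTest (f : ℕ × ℕ × ℕ → ℕ) (c r : ℕ) (v : List ℕ) : Bool :=
  decide (1 ≤ v.length) && decide
    ((f (c, v.getD (v.length - 1) 0, v.length - 1) + 2) * 2 ^ r ≤ 2 ^ (v.length - 1))

/-- The test accepts if the approximations at precision `s` prove that the points which are
`2 / 2 ^ s`-close to `seq b` have a name starting with `p 0, …, p (n - 1)`. -/
def prefixTest (f : ℕ × ℕ × ℕ → ℕ) (b s : ℕ) (p : ℕ → ℕ) (n : ℕ) : Bool :=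
  allBelow (fun i => decide ((f (b, p i, s) + 3) * 2 ^ i ≤ 2 ^ s)) n

theorem mul_two_pow_le_iff (a i s : ℕ) : a * 2 ^ i ≤ 2 ^ s ↔ (a : ℝ) / 2 ^ s ≤ 1 / 2 ^ i := by
  rw [div_le_div_iff₀ (by positivity) (by positivity), one_mul]
  exact_mod_cast Iff.rfl

/-- The constant `3` in the test pays for the distance `2 / 2 ^ s` to `seq b` and for one
approximation error of `f`. -/
theorem prefixTest_sound (hf : ApproximatesDist X f) {b s n : ℕ} {p : ℕ → ℕ}
    (h : prefixTest f b s p n = true) {y : X} (hy : dist y (seq b) < 2 / 2 ^ s) :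
    ∀ i < n, dist y (seq (p i)) < 1 / 2 ^ i := by
  intro i hi
  have h₁ := (mul_two_pow_le_iff _ _ _).1 (of_decide_eq_true (allBelow_iff.1 h i hi))
  have h₂ := hf.le b (p i) s
  have h₃ := dist_triangle y (seq b) (seq (p i))
  push_cast at h₁
  have h₄ : ((f (b, p i, s) : ℝ) + 3) / 2 ^ s = f (b, p i, s) / 2 ^ s + 1 / 2 ^ s + 2 / 2 ^ s := by
    ring
  linarith

/-- Finitely many strict inequalities leave a common slack. The constant `5` is the `3` of the test,
one error of `f` and the distance from `x` to `seq b`. -/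
theorem prefixTest_complete (hf : ApproximatesDist X f) {n : ℕ} {p : ℕ → ℕ} {x : X}
    (h : ∀ i < n, dist x (seq (p i)) < 1 / 2 ^ i) :
    ∀ᶠ s in Filter.atTop, ∀ b, dist x (seq b) < 1 / 2 ^ s → prefixTest f b s p n = true := by
  have h₀ : ∀ᶠ s in Filter.atTop, ∀ i ∈ Set.Iio n,
      (5 : ℝ) / 2 ^ s < 1 / 2 ^ i - dist x (seq (p i)) :=
    (Filter.eventually_all_finite (Set.finite_Iio n)).2 fun i hi =>
      eventually_const_div_two_pow_lt 5 (sub_pos.2 (h i hi))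
  filter_upwards [h₀] with s hs b hb
  refine allBelow_iff.2 fun i hi => decide_eq_true ((mul_two_pow_le_iff _ _ _).2 ?_)
  have h₁ := hs i hi
  have h₂ := hf.ge b (p i) s
  have h₃ := dist_triangle_left (seq b) (seq (p i)) x
  push_cast
  have h₄ : ((f (b, p i, s) : ℝ) + 3) / 2 ^ s = f (b, p i, s) / 2 ^ s + 3 / 2 ^ s := by ring
  have h₅ : (5 : ℝ) / 2 ^ s = 3 / 2 ^ s + 1 / 2 ^ s + 1 / 2 ^ s := by ring
  linarith

theorem prefixTest_congr {f : ℕ × ℕ × ℕ → ℕ} {b s n : ℕ} {p p' : ℕ → ℕ} (h : ∀ i < n, p i = p' i) :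
    prefixTest f b s p n = prefixTest f b s p' n := by
  rw [Bool.eq_iff_iff, prefixTest, prefixTest, allBelow_iff, allBelow_iff]
  exact forall₂_congr fun i hi => by rw [h i hi]

/-- The name of the open ball of radius `1 / 2 ^ r` around `seq c`. -/
def ballName (f : ℕ × ℕ × ℕ → ℕ) (c r e : ℕ) : ℕ :=
  (nearTest f c r (Denumerable.ofNat (List ℕ) e)).toNat

theorem semidecides_of_test {T : List ℕ → Bool} {U : Set X}
    (h₀ : T [] = false)
    (h : ∀ (x : X) q, IsName q x → (x ∈ U ↔ ∃ n, T (pre q (n + 1)) = true)) :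
    Semidecides (fun e => (T (Denumerable.ofNat (List ℕ) e)).toNat) U := by
  intro x q hq
  simp only [Denumerable.ofNat_encode, ne_eq, Bool.toNat_eq_zero, Bool.not_eq_false]
  rw [h x q hq]
  refine ⟨fun ⟨n, hn⟩ => ⟨n + 1, hn⟩, fun ⟨n, hn⟩ => ?_⟩
  cases n with
  | zero => simp [pre, h₀] at hn
  | succ n => exact ⟨n, hn⟩

theorem semidecides_ballName (hf : ApproximatesDist X f) (c r : ℕ) :
    Semidecides (ballName f c r) (Metric.ball (seq c : X) (1 / 2 ^ r)) := by
  refine semidecides_of_test (by simp [nearTest]) fun x q hq => ?_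
  simp only [nearTest, length_pre, Nat.le_add_left, decide_true, Bool.true_and,
    Nat.add_sub_cancel, getD_pre (Nat.lt_succ_self _), decide_eq_true_eq, mul_two_pow_le_iff]
  push_cast
  rw [Metric.mem_ball]
  have hsplit : ∀ n, ((f (c, q n, n) : ℝ) + 2) / 2 ^ n = f (c, q n, n) / 2 ^ n + 2 / 2 ^ n :=
    fun n => by ring
  have h₂ : ∀ n, (2 : ℝ) / 2 ^ n = 1 / 2 ^ n + 1 / 2 ^ n := fun n => by ring
  constructor
  · intro hx
    -- The `2` in `nearTest` covers the error of `f` and that of the name `q`; completeness needs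
    -- these two errors once more, hence `4`.
    obtain ⟨n, hn⟩ := (eventually_const_div_two_pow_lt 4 (sub_pos.2 hx)).exists
    refine ⟨n, ?_⟩
    have h₃ := hf.ge c (q n) n
    have h₄ := dist_triangle_left (seq c) (seq (q n)) x
    have h₅ := hq n
    have h₆ : (4 : ℝ) / 2 ^ n = 2 / 2 ^ n + 1 / 2 ^ n + 1 / 2 ^ n := by ring
    rw [hsplit]
    linarith
  · rintro ⟨n, hn⟩
    have h₃ := hf.le c (q n) n
    have h₄ := dist_triangle_right x (seq c) (seq (q n))
    have h₅ := hq n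
    rw [hsplit] at hn
    linarith [h₂ n]

/-- The name of the exterior of the closed ball of radius `1 / 2 ^ k` around the point named by
`p`. -/
def exteriorName (f : ℕ × ℕ × ℕ → ℕ) (p : ℕ → ℕ) (k e : ℕ) : ℕ :=
  (farTest f (p ((Denumerable.ofNat (List ℕ) e).length - 1)) k
    (Denumerable.ofNat (List ℕ) e)).toNat

theorem semidecides_exteriorName (hf : ApproximatesDist X f) {p : ℕ → ℕ} {c : X}
    (hp : IsName p c) (k : ℕ) :
    Semidecides (exteriorName f p k) (Metric.closedBall c (1 / 2 ^ k))ᶜ := by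
  refine semidecides_of_test (T := fun v => farTest f (p (v.length - 1)) k v)
    (by simp [farTest]) fun x q hq => ?_
  -- Three errors occur here: that of `f` and those of the names of the centre and of the point.
  -- Soundness uses `3`, completeness `6`.
  have hiff : ∀ n, 3 * 2 ^ k + 2 ^ n ≤ f (p n, q n, n) * 2 ^ k ↔
      (1 : ℝ) / 2 ^ k + 3 / 2 ^ n ≤ f (p n, q n, n) / 2 ^ n := fun n => by
    rw [div_add_div _ _ (by positivity) (by positivity),
      div_le_div_iff₀ (by positivity) (by positivity), ← mul_assoc,
      mul_le_mul_iff_left₀ (by positivity), ← Nat.cast_le (α := ℝ)]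
    push_cast
    rw [one_mul, add_comm, mul_comm (3 : ℝ)]
  simp only [farTest, length_pre, Nat.le_add_left, decide_true, Bool.true_and,
    Nat.add_sub_cancel, getD_pre (Nat.lt_succ_self _), decide_eq_true_eq, hiff]
  rw [Set.mem_compl_iff, Metric.mem_closedBall, not_le]
  constructor
  · intro hx
    obtain ⟨n, hn⟩ := (eventually_const_div_two_pow_lt 6 (sub_pos.2 hx)).exists
    refine ⟨n, ?_⟩
    have h₃ := hf.le (p n) (q n) n
    have h₄ := dist_triangle4 x (seq (q n)) (seq (p n)) c
    rw [dist_comm (seq (q n)), dist_comm (seq (p n)) c] at h₄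
    have h₅ := hq n
    have h₆ := hp n
    have h₇ : (6 : ℝ) / 2 ^ n = 3 / 2 ^ n + 1 / 2 ^ n + 1 / 2 ^ n + 1 / 2 ^ n := by ring
    linarith
  · rintro ⟨n, hn⟩
    have h₃ := hf.ge (p n) (q n) n
    have h₄ := dist_triangle4 (seq (p n)) c x (seq (q n))
    rw [dist_comm _ c, dist_comm c x] at h₄
    have h₅ := hq n
    have h₆ := hp n
    have h₇ : (3 : ℝ) / 2 ^ n = 1 / 2 ^ n + 1 / 2 ^ n + 1 / 2 ^ n := by ring
    linarith

theorem exteriorName_congr {p p' : ℕ → ℕ} {k e : ℕ} (h : ∀ i ≤ e, p i = p' i) :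
    exteriorName f p k e = exteriorName f p' k e := by
  unfold exteriorName
  rw [h _ ((Nat.sub_le _ _).trans (length_ofNat_le e))]

/-! ### Computability of the tests -/

variable {α : Type*} [Primcodable α]

theorem computable_prefixTest (hf : Computable f) {b s n : α → ℕ} {p : α → ℕ → ℕ}
    (hb : Computable b) (hs : Computable s) (hp : Computable₂ p) (hn : Computable n) :
    Computable fun a => prefixTest f (b a) (s a) (p a) (n a) := by
  refine computable_allBelow (Computable₂.mk (computable_le (computable_mul (computable_add
    (hf.comp ((hb.comp Computable.fst).pair (Computable.pair hp (hs.comp Computable.fst))))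
    (Computable.const 3)) (computable_two_pow Computable.snd))
    (computable_two_pow (hs.comp Computable.fst)))) hn

theorem computable_ballName (hf : Computable f) {c r e : α → ℕ} (hc : Computable c)
    (hr : Computable r) (he : Computable e) : Computable fun a => ballName f (c a) (r a) (e a) := by
  have hv : Computable fun a => Denumerable.ofNat (List ℕ) (e a) := (Computable.ofNat _).comp he
  have hl := Computable.list_length.comp hv
  have hl' := computable_sub hl (Computable.const 1)
  exact computable_toNat (computable_and (computable_le (Computable.const 1) hl)
    (computable_le (computable_mul (computable_add (hf.comp (hc.pair
      ((computable_getD hv hl' (Computable.const 0)).pair hl'))) (Computable.const 2))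
      (computable_two_pow hr)) (computable_two_pow hl')))

theorem computable_exteriorName (hf : Computable f) {p : α → ℕ → ℕ} {k e : α → ℕ}
    (hp : Computable₂ p) (hk : Computable k) (he : Computable e) :
    Computable fun a => exteriorName f (p a) (k a) (e a) := by
  have hv : Computable fun a => Denumerable.ofNat (List ℕ) (e a) := (Computable.ofNat _).comp he
  have hl := Computable.list_length.comp hv
  have hl' := computable_sub hl (Computable.const 1)
  have h2k := computable_two_pow hk
  exact computable_toNat (computable_and (computable_le (Computable.const 1) hl)
    (computable_le (computable_add (computable_mul (Computable.const 3) h2k)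
      (computable_two_pow hl')) (computable_mul (hf.comp ((hp.comp Computable.id hl').pair
      ((computable_getD hv hl' (Computable.const 0)).pair hl'))) h2k)))

end Metric

/-! ### Effective relatively compact systems of metric spaces -/

section Main

variable {X : Type*} [MetricSpace X] [ComputableMetricSpace X]

/-- A computable metric space admits an ercs as soon as there is a computable family of closed
balls with names of compact sets containing them, such that the balls of the family form
neighbourhood bases. -/
theorem admitsErcs_of_balls {f : ℕ × ℕ × ℕ → ℕ} (hfc : Computable f) (hf : ApproximatesDist X f)
    {c r : ℕ → ℕ} {good : ℕ → Bool} {Q : ℕ → ℕ → ℕ} (hc : Computable c) (hr : Computable r)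
    (hgood : Computable good) (hQ : Computable₂ Q)
    (hK : ∀ n, good n = true → ∃ K : Set X, Metric.closedBall (seq (c n)) (1 / 2 ^ r n) ⊆ K ∧
      Semidecides (Q n) {V : OpenSet X | K ⊆ V.carrier})
    (hcov : ∀ (x : X) (V : Set X), IsOpen V → x ∈ V → ∃ n, good n = true ∧
      x ∈ Metric.ball (seq (c n)) (1 / 2 ^ r n) ∧
      Metric.closedBall (seq (c n)) (1 / 2 ^ r n) ⊆ V) :
    AdmitsErcs X := by
  -- Rejected indices get the empty set: the constant `1` names it as a compact set, the constant
  -- `0` as an open set.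
  let bName : ℕ → ℕ → ℕ := fun n e =>
    bif good n then sdiffName (Q n) (exteriorName f (fun _ => c n) (r n)) e else 1
  let bSet : ℕ → Set X := fun n =>
    {y | good n = true ∧ y ∈ Metric.closedBall (seq (c n)) (1 / 2 ^ r n)}
  let uName : ℕ → ℕ → ℕ := fun n e => bif good n then ballName f (c n) (r n) e else 0
  let uSet : ℕ → Set X := fun n => {y | good n = true ∧ y ∈ Metric.ball (seq (c n)) (1 / 2 ^ r n)}
  have hb : ∀ n, Semidecides (bName n) {V : OpenSet X | bSet n ⊆ V.carrier} := by
    intro n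
    cases hn : good n
    · intro V q _
      simp [bName, bSet, hn]
    · obtain ⟨K, h₁, h₂⟩ := hK n hn
      convert semidecides_sdiffName_of_subset h₂
        (semidecides_exteriorName hf (isName_const (X := X) (c n)) (r n)) h₁ using 1
      · funext e
        simp [bName, hn]
      · have : bSet n = Metric.closedBall (seq (c n)) (1 / 2 ^ r n) := by
          ext y
          simp [bSet, hn]
        rw [this]
  have hu : ∀ n, Semidecides (uName n) (uSet n) := by
    intro n
    cases hn : good n
    · intro x q _
      simp [uName, uSet, hn]
    · convert semidecides_ballName hf (c n) (r n) using 1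
      · funext e
        simp [uName, hn]
      · ext y
        simp [uSet, hn]
  have hg : Computable fun z : ℕ × ℕ => good z.1 := hgood.comp Computable.fst
  have hbc : Computable₂ bName := by
    have hext : Computable₂ fun n e => exteriorName f (fun _ => c n) (r n) e :=
      computable_exteriorName hfc (Computable₂.mk (hc.comp (Computable.fst.comp Computable.fst)))
        (hr.comp Computable.fst) Computable.snd
    exact Computable.cond hg (computable_sdiffName hQ hext) (Computable.const 1)
  have huc : Computable₂ uName := Computable.cond hg (computable_ballName hfc
    (hc.comp Computable.fst) (hr.comp Computable.fst) Computable.snd) (Computable.const 0)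
  have hsub : ∀ n, uSet n ⊆ bSet n := fun n y hy => ⟨hy.1, Metric.ball_subset_closedBall hy.2⟩
  refine ⟨{
    U := fun n => ⟨uSet n, _, hu n⟩
    B := fun n => CompactSet.ofSemidecides (bSet n) _ (hb n)
    -- Each open ball is paired only with its own closed ball.
    R := {z | z.1 = z.2}
    computable_U := isComputableMap_nat_iff.2 ⟨uName, huc, hu⟩
    computable_B := isComputableMap_nat_iff.2 ⟨bName, hbc, hb⟩
    re_R := ?_
    subset_of_mem := ?_
    eq_iUnion := fun V => ?_ }⟩
  · exact (PrimrecRel.decide Primrec.eq).to_comp.computablePred.to_re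
  · rintro m n (rfl : m = n)
    exact hsub m
  · ext x
    simp only [Set.mem_iUnion]
    constructor
    · intro hx
      obtain ⟨n, h₁, h₂, h₃⟩ := hcov x V.carrier V.isOpen hx
      exact ⟨n, fun y hy => h₃ hy.2, n, rfl, h₁, h₂⟩
    · rintro ⟨n, hn, m, hmn, hm⟩
      obtain rfl : m = n := hmn
      exact hn (hsub m hm)

/-- Small balls around points of the dense sequence. -/
theorem exists_ball_seq {V : Set X} (hV : IsOpen V) {x : X} (hx : x ∈ V) (n : ℕ) :
    ∃ i r, n ≤ r ∧ x ∈ Metric.ball (seq i) (1 / 2 ^ r) ∧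
      Metric.closedBall (seq i : X) (1 / 2 ^ r) ⊆ V := by
  obtain ⟨ε, hε, h⟩ := Metric.isOpen_iff.1 hV x hx
  obtain ⟨r, hr, hnr⟩ :=
    ((eventually_const_div_two_pow_lt 2 hε).and (Filter.eventually_ge_atTop n)).exists
  obtain ⟨i, hi⟩ := (dense_seq (X := X)).exists_dist_lt x (by positivity : (0 : ℝ) < 1 / 2 ^ r)
  refine ⟨i, r, hnr, hi, fun y hy => h ?_⟩
  rw [Metric.mem_closedBall] at hy
  rw [Metric.mem_ball]
  have h₁ := dist_triangle_right y x (seq i)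
  have : (2 : ℝ) / 2 ^ r = 1 / 2 ^ r + 1 / 2 ^ r := by ring
  linarith

theorem IsComputablyCompact.admitsErcs (h : IsComputablyCompact X) : AdmitsErcs X := by
  obtain ⟨f, hfc, hf⟩ := dist_computable (X := X)
  obtain ⟨K, hK, p, hp, hpK⟩ := h
  refine admitsErcs_of_balls hfc hf (c := fun n => n.unpair.1) (r := fun n => n.unpair.2)
    (good := fun _ => true) (Q := fun _ => p) (Computable.fst.comp Computable.unpair)
    (Computable.snd.comp Computable.unpair) (Computable.const true) (hp.comp Computable.snd)
    (fun n _ => ⟨K.carrier, hK ▸ Set.subset_univ _, hpK⟩) fun x V hV hx => ?_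
  obtain ⟨i, r, -, h₁, h₂⟩ := exists_ball_seq hV hx 0
  exact ⟨Nat.pair i r, rfl, by simpa using h₁, by simpa using h₂⟩

theorem admitsErcs_of_compactBall (hne : ∀ x : X, (compactBall X x).Nonempty)
    (hcomp : IsComputableMulti (compactBall X)) : AdmitsErcs X := by
  obtain ⟨f, hfc, hf⟩ := dist_computable (X := X)
  obtain ⟨φ, hφ, h⟩ := hcomp
  let D : ℕ → List ℕ × ℕ × ℕ × ℕ := Denumerable.ofNat _
  -- An index codes a word `w`, a centre `i`, a precision for `prefixTest` and a radius exponent. It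
  -- is good if the machine has announced some `n₀` at most that exponent after reading `w`, and
  -- `seq i` provably has a name starting with `w`.
  let good : ℕ → Bool := fun n =>
    ((φ (D n).1 0).map fun n₀ => decide (n₀ ≤ (D n).2.2.2)).getD false &&
      prefixTest f (D n).2.1 (D n).2.2.1 (fun i => (D n).1.getD i 0) (D n).1.length
  let P : ℕ → ℕ → ℕ := fun n i => (D n).1.getD i (D n).2.1
  have hP : ∀ n, good n = true → ∃ n₀ ≤ (D n).2.2.2, ∃ q : ℕ → ℕ, Yields φ (P n) q ∧
      Semidecides (fun e => q (2 * e + 1))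
        {V : OpenSet X | Metric.closedBall (seq (D n).2.1) (1 / 2 ^ n₀) ⊆ V.carrier} := by
    intro n hn
    obtain ⟨h₁, h₂⟩ := Bool.and_eq_true_iff.1 hn
    have hname : IsName (P n) (seq (D n).2.1 : X) := by
      intro i
      by_cases hi : i < (D n).1.length
      · have := prefixTest_sound hf h₂ (y := seq (D n).2.1) (by rw [dist_self]; positivity) i hi
        simp only [P]
        rwa [List.getD_eq_getElem _ _ hi] at this ⊢
      · simp only [P]
        rw [List.getD_eq_default _ _ (not_lt.1 hi), dist_self]
        positivity
    obtain ⟨q, hq, ⟨n₀, K⟩, hK, hqn, hqK⟩ := h _ (hne _) _ hname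
    rcases hφn : φ (D n).1 0 with _ | k
    · simp [hφn] at h₁
    · have hk : q 0 = k := (hq 0 k).1 ⟨(D n).1.length, by rw [pre_getD, hφn]⟩
      have hk' : k = n₀ := hk.symm.trans hqn
      refine ⟨n₀, by simpa [hφn, hk'] using h₁, q, hq, ?_⟩
      have hK' : K.carrier = Metric.closedBall (seq (D n).2.1) (1 / 2 ^ n₀) := hK
      rw [← hK']
      exact hqK
  have hD : Computable D := Computable.ofNat _
  have hDw := Computable.fst.comp hD
  have hDi := Computable.fst.comp (Computable.snd.comp hD)
  have hDk := Computable.fst.comp (Computable.snd.comp (Computable.snd.comp hD))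
  have hDr := Computable.snd.comp (Computable.snd.comp (Computable.snd.comp hD))
  have hgood : Computable good := by
    refine computable_and (Computable.option_getD (Computable.option_map
      (hφ.comp hDw (Computable.const 0)) (Computable₂.mk (computable_le Computable.snd
        (hDr.comp Computable.fst)))) (Computable.const false)) ?_
    exact computable_prefixTest hfc hDi hDk (Computable₂.mk (computable_getD
      (hDw.comp Computable.fst) Computable.snd (Computable.const 0)))
      (Computable.list_length.comp hDw)
  have hPc : Computable₂ P := computable_getD (hDw.comp Computable.fst) Computable.snd
    (hDi.comp Computable.fst)
  -- Odd output symbols form the name of the ball. The default `some 0` makes the search terminate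
  -- at bad indices too.
  have hF : Computable₂ fun (z : ℕ × ℕ) m =>
      (bif good z.1 then φ (pre (P z.1) m) (2 * z.2 + 1) else some 0 : Option ℕ) := by
    have hz₁ : Computable fun y : (ℕ × ℕ) × ℕ => y.1.1 := Computable.fst.comp Computable.fst
    refine Computable.cond (hgood.comp hz₁) (hφ.comp (computable_pre
      (Computable₂.mk (hPc.comp (hz₁.comp Computable.fst) Computable.snd)) Computable.snd) ?_)
      (Computable.const (some 0))
    exact computable_add (computable_mul (Computable.const 2)
      (Computable.snd.comp Computable.fst)) (Computable.const 1)
  obtain ⟨Q, hQ, hQ'⟩ := exists_computable_of_search hF fun z => by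
    cases hn : good z.1
    · exact ⟨0, 0, by simp⟩
    · obtain ⟨n₀, -, q, hq, -⟩ := hP z.1 hn
      obtain ⟨m, hm⟩ := (hq (2 * z.2 + 1) _).2 rfl
      exact ⟨m, _, by simpa using hm⟩
  refine admitsErcs_of_balls hfc hf hDi hDr hgood (Q := fun n e => Q (n, e)) hQ
    (fun n hn => ?_) fun x V hV hx => ?_
  · obtain ⟨n₀, h₀, q, hq, hs⟩ := hP n hn
    refine ⟨Metric.closedBall (seq (D n).2.1) (1 / 2 ^ n₀), ?_, ?_⟩
    · refine Metric.closedBall_subset_closedBall ?_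
      exact one_div_le_one_div_of_le (by positivity) (pow_le_pow_right₀ one_le_two h₀)
    · convert hs using 1
      funext e
      obtain ⟨m, hm⟩ := hQ' (n, e)
      exact ((hq _ _).1 ⟨m, by simpa [hn] using hm⟩).symm
  · obtain ⟨p, hp⟩ := exists_name x
    obtain ⟨q, hq, ⟨n₀, K⟩, -, hqn, -⟩ := h x (hne x) p hp
    have hq₀ : q 0 = n₀ := hqn
    -- The exponent is fixed after `l` symbols; shrinking the ball into the set of points compatible
    -- with these symbols lets its centre share the prefix.
    obtain ⟨l, hl⟩ := (hq 0 _).2 hq₀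
    obtain ⟨i, r, hr, h₁, h₂⟩ := exists_ball_seq (hV.inter (isOpen_setOf_prefix p l))
      ⟨hx, fun i _ => hp i⟩ n₀
    have hi := (h₂ (Metric.mem_closedBall_self (by positivity))).2
    obtain ⟨k, hk⟩ := (prefixTest_complete hf hi).exists
    have hDn : D (Encodable.encode (pre p l, i, k, r)) = (pre p l, i, k, r) :=
      Denumerable.ofNat_encode _
    refine ⟨Encodable.encode (pre p l, i, k, r), ?_, by rwa [hDn], ?_⟩
    · simp only [good, hDn, hl, Option.map_some, Option.getD_some, hr, decide_true, Bool.true_and,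
        length_pre]
      refine allBelow_iff.2 fun j hj => ?_
      simp only [getD_pre hj]
      exact allBelow_iff.1 (hk i (by rw [dist_self]; positivity)) j hj
    · rw [hDn]
      exact h₂.trans Set.inter_subset_left

theorem AdmitsErcs.compactBall (h : AdmitsErcs X) :
    (∀ x : X, (compactBall X x).Nonempty) ∧ IsComputableMulti (compactBall X) := by
  obtain ⟨f, hfc, hf⟩ := dist_computable (X := X)
  obtain ⟨S⟩ := h
  obtain ⟨u, huc, hu⟩ := isComputableMap_nat_iff.1 S.computable_U
  obtain ⟨b, hbc, hb⟩ := isComputableMap_nat_iff.1 S.computable_B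
  obtain ⟨g, hgc, hg⟩ := exists_computable_of_rePred S.re_R
  -- A number codes a formal inclusion, a witness for it, and a length.
  let D : ℕ → (ℕ × ℕ) × ℕ × ℕ := fun s => Denumerable.ofNat _ s.unpair.1
  -- On a word of length `s + 1`, the number `s` is at once the coded search candidate, the exponent
  -- of the radius and the position of the approximate centre `p s`.
  let good : List ℕ → Bool := fun w =>
    decide (1 ≤ w.length) && (decide ((D (w.length - 1)).2.2 ≤ w.length) &&
      (g (D (w.length - 1)).1 (D (w.length - 1)).2.1 &&
      (decide (1 ≤ u (D (w.length - 1)).1.1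
        (Encodable.encode (w.take (D (w.length - 1)).2.2))) &&
      prefixTest f (w.getD (w.length - 1) 0) (w.length - 1) (fun i => w.getD i 0)
        (D (w.length - 1)).2.2)))
  let out : List ℕ → ℕ → ℕ → ℕ := fun w s e =>
    bif e.bodd then sdiffName (b (D (s - 1)).1.2)
      (exteriorName f (fun i => w.getD i 0) (s - 1)) e.div2 else s - 1
  have hgood : ∀ p s, good (pre p (s + 1)) = true ↔ (D s).2.2 ≤ s + 1 ∧
      g (D s).1 (D s).2.1 = true ∧ u (D s).1.1 (Encodable.encode (pre p (D s).2.2)) ≠ 0 ∧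
      prefixTest f (p s) s p (D s).2.2 = true := by
    intro p s
    simp only [good, length_pre, Nat.le_add_left, decide_true, Bool.true_and, Nat.add_sub_cancel,
      Bool.and_eq_true, decide_eq_true_eq, getD_pre s.lt_succ_self]
    refine and_congr_right fun hs => ?_
    rw [take_pre hs, Nat.one_le_iff_ne_zero,
      prefixTest_congr fun i hi => getD_pre (hi.trans_le hs) 0]
  have hex : ∀ (x : X) p, IsName p x → ∃ s, good (pre p s) = true := by
    intro x p hp
    -- The covering property for the whole space already puts `x` in some `U m` with `(m, n) ∈ R`.
    have hx : x ∈ (OpenSet.ofIsOpen (Set.univ : Set X) isOpen_univ).carrier := Set.mem_univ x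
    rw [S.eq_iUnion] at hx
    simp only [Set.mem_iUnion] at hx
    obtain ⟨n, -, m, hmn, hxm⟩ := hx
    obtain ⟨t, ht⟩ := (hg (m, n)).1 hmn
    obtain ⟨j, hj⟩ := (hu m x p hp).1 hxm
    obtain ⟨N, hN⟩ := Filter.eventually_atTop.1
      (prefixTest_complete hf (n := j) (p := p) fun i _ => hp i)
    -- `D` ignores the second component, so padding it makes `s` as large as required without
    -- changing the decoded data.
    let s := Nat.pair (Encodable.encode ((m, n), t, j)) (max N j)
    have hs : max N j ≤ s := Nat.right_le_pair _ _
    have hDs : D s = ((m, n), t, j) := by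
      simp only [D, s, Nat.unpair_pair, Denumerable.ofNat_encode]
    refine ⟨s + 1, (hgood p s).2 ?_⟩
    rw [hDs]
    exact ⟨((le_max_right N j).trans hs).trans s.le_succ, ht, hj, hN s ((le_max_left N j).trans hs) _ (hp s)⟩
  have hval : ∀ (x : X) p s, IsName p x → good (pre p s) = true →
      ∃ y ∈ CompAnalysis.compactBall X x, IsName (fun e => out (pre p (e + 1)) s e) y := by
    rintro x p (_ | s) hp hs
    · simp [good] at hs
    obtain ⟨-, h₁, h₂, h₃⟩ := (hgood p s).1 hs
    -- Points of this ball are within `2 / 2 ^ s` of `seq (p s)`, hence compatible with the prefix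
    -- on which `U m` was accepted.
    have hsub : Metric.closedBall x (1 / 2 ^ s) ⊆ (S.B (D s).1.2).carrier := by
      refine Set.Subset.trans (fun y hy => ?_) (S.subset_of_mem _ _ ((hg (D s).1).2 ⟨_, h₁⟩))
      refine (show Semidecides _ _ from hu _).mem_of_prefix h₂ (prefixTest_sound hf h₃ ?_)
      have h₄ := dist_triangle y x (seq (p s))
      have h₅ := hp s
      rw [Metric.mem_closedBall] at hy
      have : (2 : ℝ) / 2 ^ s = 1 / 2 ^ s + 1 / 2 ^ s := by ring
      linarith
    have hname := semidecides_sdiffName_of_subset (hb (D s).1.2)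
      (semidecides_exteriorName hf hp s) hsub
    refine ⟨(s, CompactSet.ofSemidecides _ _ hname), rfl, ?_, ?_⟩
    · change out _ _ _ = s
      simp [out]
    · change Semidecides (fun e => out (pre p (2 * e + 1 + 1)) (s + 1) (2 * e + 1))
        {U : OpenSet X | Metric.closedBall x (1 / 2 ^ s) ⊆ U.carrier}
      convert hname using 1
      funext e
      have he : (2 * e + 1).div2 = e := by simp [Nat.div2_val]
      simp only [out, Nat.add_sub_cancel, he]
      rw [show (2 * e + 1).bodd = true by simp, cond_true]
      -- Only entries of `p` below `e` are consulted, and the available prefix has length `2 * e +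
      -- 2`.
      exact sdiffName_congr fun i hi => exteriorName_congr fun j hj => getD_pre (by omega) 0
  have hgoodc : Computable good := by
    have hw : Computable fun w : List ℕ => w := Computable.id
    have hl : Computable fun w : List ℕ => w.length := Computable.list_length
    have hl' := computable_sub hl (Computable.const 1)
    have hD : Computable fun w : List ℕ => D (w.length - 1) := (Computable.ofNat _).comp
      (Computable.fst.comp (Computable.unpair.comp hl'))
    have hD₁ := Computable.fst.comp hD
    have hDj := Computable.snd.comp (Computable.snd.comp hD)
    exact computable_and (computable_le (Computable.const 1) hl)
      (computable_and (computable_le hDj hl)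
      (computable_and (hgc.comp hD₁ (Computable.fst.comp (Computable.snd.comp hD)))
      (computable_and (computable_le (Computable.const 1) (huc.comp (Computable.fst.comp hD₁)
        (Computable.encode.comp (computable_take hw hDj))))
      (computable_prefixTest hfc (computable_getD hw hl' (Computable.const 0)) hl'
        (Computable₂.mk (computable_getD Computable.fst Computable.snd (Computable.const 0)))
        hDj))))
  have houtc : Computable fun z : List ℕ × ℕ × ℕ => out z.1 z.2.1 z.2.2 := by
    have he : Computable fun z : List ℕ × ℕ × ℕ => z.2.2 := Computable.snd.comp Computable.snd
    have hs : Computable fun z : List ℕ × ℕ × ℕ => z.2.1 - 1 :=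
      computable_sub (Computable.fst.comp Computable.snd) (Computable.const 1)
    have hD : Computable fun z : List ℕ × ℕ × ℕ => D (z.2.1 - 1) := (Computable.ofNat _).comp
      (Computable.fst.comp (Computable.unpair.comp hs))
    have hK : Computable₂ fun (z : List ℕ × ℕ × ℕ) e => sdiffName (b (D (z.2.1 - 1)).1.2)
        (exteriorName f (fun i => z.1.getD i 0) (z.2.1 - 1)) e := by
      refine computable_sdiffName (Computable₂.mk (hbc.comp (Computable.snd.comp
        (Computable.fst.comp (hD.comp Computable.fst))) Computable.snd)) ?_
      exact Computable₂.mk (computable_exteriorName hfc (Computable₂.mk (computable_getD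
        (Computable.fst.comp (Computable.fst.comp Computable.fst)) Computable.snd
        (Computable.const 0))) (hs.comp Computable.fst) Computable.snd)
    exact Computable.cond (Computable.nat_bodd.comp he)
      (hK.comp Computable.id (Computable.nat_div2.comp he)) hs
  -- Well-definedness comes from the same search, run on any name of `x`.
  refine ⟨fun x => ?_, isComputableMulti_of_search hgoodc houtc hex hval⟩
  obtain ⟨p, hp⟩ := exists_name x
  obtain ⟨s, hs⟩ := hex x p hp
  obtain ⟨y, hy, -⟩ := hval x p s hp hs
  exact ⟨y, hy⟩

end Main

end CompAnalysis

theorem proposition12 (X : Type*) [MetricSpace X] [CompAnalysis.ComputableMetricSpace X] :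
    (CompAnalysis.AdmitsErcs X ↔
      (∀ x : X, (CompAnalysis.compactBall X x).Nonempty) ∧
        CompAnalysis.IsComputableMulti (CompAnalysis.compactBall X)) ∧
    (CompAnalysis.IsComputablyCompact X → CompAnalysis.AdmitsErcs X) :=
  ⟨⟨CompAnalysis.AdmitsErcs.compactBall, fun h => CompAnalysis.admitsErcs_of_compactBall h.1 h.2⟩,
    CompAnalysis.IsComputablyCompact.admitsErcs⟩
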